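/- All graphs are finite and simple. For positive integers $a,b$, an $a{:}b$-coloring of a graph $G$ assigns to each vertex a $b$-element subset of $\{1,\dots,a\}$ so that adjacent vertices receive disjoint subsets; $\chi_b(G)$ is the least $a$ for which an $a{:}b$-coloring exists, and the fractional chromatic number is $\chi_f(G)=\inf_{b\ge 1}\chi_b(G)/b$. A graph $G$ is $H$-free if it has no (not necessarily induced) subgraph isomorphic to $H$. The fractional chromatic threshold of $H$ is $$\delta_{\chi_f}(H)=\inf\{d\in\mathbb R:\ \exists\, C=C(H,d)\text{ such that every }H\text{-free graph }G\text{ on }n\text{ vertices with minimum degree }\delta(G)\ge dn\text{ has }\chi_f(G)\le C\}.$$ For a graph $H$ with $\chi(H)=r\ge 3$, the decomposition family $\mathcal M(H)$ consists of all (bipartite) graphs obtained from $H$ by deleting $r-2$ color classes in an $r$-coloring of $H$. **Theorem.** Let $H$ be a graph with $\chi(H)=r\ge 3$. Then the set defining $\delta_{\chi_f}(H)$ is non-empty and bounded below, and $$\delta_{\chi_f}(H)=\begin{cases}\dfrac{r-3}{r-2} & \text{if }\mathcal M(H)\text{ contains a forest},\\[2mm] \dfrac{r-2}{r-1} & \text{otherwise.}\end{cases}$$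 Moreover, if $\mathcal M(H)$ contains a forest, then for every $\varepsilon>0$ there is a constant $C=C(\varepsilon,H)$ such that every $n$-vertex $H$-free graph $G$ with $\delta(G)\ge\left(\frac{r-3}{r-2}+\varepsilon\right)n$ satisfies $\chi_f(G)\le C$. -/

import Mathlib

namespace SimpleGraph

/-- An `a : b`-coloring of `G`: every vertex receives a `b`-element subset of a palette of `a`
colors, and adjacent vertices receive disjoint subsets. -/
def HasFoldColoring {V : Type*} (G : SimpleGraph V) (a b : ℕ) : Prop :=
  ∃ f : V → Finset (Fin a), (∀ v, (f v).card = b) ∧ ∀ u v, G.Adj u v → Disjoint (f u) (f v)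

/-- The `b`-fold chromatic number `χ_b(G)`: the smallest `a` such that `G` has an
`a : b`-coloring. -/
noncomputable def foldChromaticNumber {V : Type*} (G : SimpleGraph V) (b : ℕ) : ℕ :=
  sInf {a : ℕ | G.HasFoldColoring a b}

/-- A finite graph has an `a : b`-coloring for some `a`, so the infimum defining `χ_b(G)` is
attained. -/
theorem exists_hasFoldColoring {V : Type*} [Finite V] (G : SimpleGraph V) (b : ℕ) :
    ∃ a, G.HasFoldColoring a b := by
  classical
  obtain ⟨n, ⟨e⟩⟩ := Finite.exists_equiv_fin V
  refine ⟨n * b, fun v => Finset.univ.map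
    ⟨fun j : Fin b => finProdFinEquiv (e v, j), fun i j h => by simpa using h⟩, by simp, ?_⟩
  intro u v huv
  rw [Finset.disjoint_left]
  intro x hx hy
  simp only [Finset.mem_map, Finset.mem_univ, true_and] at hx hy
  obtain ⟨i, rfl⟩ := hx
  obtain ⟨j, hj⟩ := hy
  have h := finProdFinEquiv.injective hj
  exact huv.ne (e.injective (Prod.ext_iff.1 h).1.symm)

/-- The fractional chromatic number `χ_f(G) = inf_{b ≥ 1} χ_b(G) / b` of a finite graph. -/
noncomputable def fractionalChromaticNumber {V : Type*} [Finite V] (G : SimpleGraph V) : ℝ :=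
  ⨅ b : ℕ+, (G.foldChromaticNumber (b : ℕ) : ℝ) / ((b : ℕ) : ℝ)

/-- The reals `d` for which there is a constant `C` (depending only on `H` and `d`) such that
every finite `H`-free graph `G` on `n` vertices with `δ(G) ≥ d n` has `χ_f(G) ≤ C`. -/
def fractionalThresholdSet {W : Type*} (H : SimpleGraph W) : Set ℝ :=
  {d : ℝ | ∃ C : ℝ, ∀ (V : Type) [Fintype V] (G : SimpleGraph V) [DecidableRel G.Adj],
    d * (Fintype.card V : ℝ) ≤ (G.minDegree : ℝ) → H.Free G → G.fractionalChromaticNumber ≤ C}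

/-- The fractional chromatic threshold `δ_{χ_f}(H)`. -/
noncomputable def fractionalChromaticThreshold {W : Type*} (H : SimpleGraph W) : ℝ :=
  sInf H.fractionalThresholdSet

/-- The decomposition family `M(H)` of a graph `H` of chromatic number `r`: all graphs obtained
from `H` by deleting `r - 2` color classes of an `r`-coloring of `H`. The two remaining classes
make these graphs bipartite. -/
def decompositionFamily {W : Type*} (H : SimpleGraph W) (r : ℕ) : Set H.Subgraph :=
  {F | ∃ (c : H.Coloring (Fin r)) (S : Finset (Fin r)), S.card + 2 = r ∧
    F = (⊤ : H.Subgraph).deleteVerts {w | c w ∈ S}}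

end SimpleGraph

/-! Say that `H` splits at level `s` if its vertices partition into `s` independent sets and a set
inducing a forest (`HasForestPartition`). For `χ(H) = r`, the family `M(H)` contains a forest
exactly when `H` splits at level `r - 2`. Level `r - 1` always works (the last color class is an
edgeless forest), and level `r - 3` never does, since a forest is 2-colorable. It remains to show
that splitting at level `s + 1` but not at level `s` gives the threshold `s / (s + 1)`
(`isGLB_fractionalThresholdSet`).

Upper bound (`HasForestPartition.exists_fractionalChromaticNumber_le`): let `t = |H|` and let the
minimum degree exceed `((s - 1) / s + ε) n`. Any `s` vertices have at least `ε n` common neighbours,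
so greedy counting and power means show that every neighbourhood contains a positive proportion `p`
of all possible labelled complete `s`-partite graphs with parts of size `t` (`le_card_blowup`). The
common neighbourhood of one such graph `y` is `t`-colorable: otherwise it has a subgraph of minimum
degree at least `t`, which contains the forest of `H`, and `y` supplies the rest of `H`. Giving `v`
the color `(y, c y v)` for every `y` in its neighbourhood is a fractional coloring of weight `O(t /
p)`.

Lower bound (`lt_of_mem_fractionalThresholdSet`): a graph without cycles of length at most `|H|` and
with only small independent sets has large `χ_f`. Placed in one part of a balanced complete `(s +
1)`-partite graph, it gives minimum degree `s n / (s + 1)`, and a copy of `H` would split `H` at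
level `s`. Such graphs come from the deletion method, carried out by counting lists of pairs. -/

namespace SimpleGraph

/-! ### Forests and degenerate graphs -/

/-- A finite nonempty acyclic graph has a vertex with at most one neighbour. -/
theorem IsAcyclic.exists_forall_adj_eq {W : Type*} [Finite W] [Nonempty W] {F : SimpleGraph W}
    (hF : F.IsAcyclic) : ∃ v, ∀ a b, F.Adj v a → F.Adj v b → a = b := by
  classical
  have := Fintype.ofFinite W
  -- A maximal acyclic graph above `F` is a spanning tree; its leaves have at most one neighbour in
  -- `F`.
  obtain ⟨T, hFT, hT⟩ := exists_maximal_isAcyclic_of_le_isAcyclic (G := (⊤ : SimpleGraph W)) le_top hF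
  have hT : T.IsTree := by
    rw [isTree_iff_maximal_isAcyclic]
    refine ⟨inferInstance, hT.1.2, fun K hK h => hT.2 ⟨le_top, hK⟩ h⟩
  rcases subsingleton_or_nontrivial W with h | h
  · exact ⟨Classical.arbitrary W, fun a b _ _ => Subsingleton.elim _ _⟩
  · obtain ⟨v, hv⟩ := hT.exists_vert_degree_one_of_nontrivial
    refine ⟨v, fun a b ha hb => ?_⟩
    rw [degree_eq_one_iff_existsUnique_adj] at hv
    exact hv.unique (hFT ha) (hFT hb)

/-- A forest on at most `k` vertices can be embedded into every nonempty vertex set that induces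
minimum degree at least `k`. -/
theorem IsAcyclic.exists_injOn_map_adj {V W : Type*} [DecidableEq V] {F : SimpleGraph W}
    (hF : F.IsAcyclic) (G : SimpleGraph V) [DecidableRel G.Adj] {A : Finset V} (hA₀ : A.Nonempty)
    {k : ℕ} (hA : ∀ v ∈ A, k ≤ (A.filter (G.Adj v)).card) (S : Finset W) (hS : S.card ≤ k) :
    ∃ f : W → V, Set.InjOn f S ∧ (∀ w ∈ S, f w ∈ A) ∧
      ∀ a ∈ S, ∀ b ∈ S, F.Adj a b → G.Adj (f a) (f b) := by
  classical
  induction S using Finset.strongInduction with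
  | H S ih =>
  obtain ⟨v₀, hv₀⟩ := hA₀
  rcases S.eq_empty_or_nonempty with rfl | ⟨w₀, hw₀⟩
  · exact ⟨fun _ => v₀, by simp, by simp, by simp⟩
  have : Nonempty (S : Set W) := ⟨⟨w₀, hw₀⟩⟩
  obtain ⟨⟨w, hw⟩, huniq⟩ := (hF.induce (S : Set W)).exists_forall_adj_eq
  have hw : w ∈ S := hw
  obtain ⟨f, hinj, hmem, hadj⟩ := ih (S.erase w) (Finset.erase_ssubset hw)
    ((Finset.card_erase_le).trans hS)
  -- Fewer than `k` vertices are in use, so every vertex of `A` still has an unused neighbour in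
  -- `A`.
  have hcard : ((S.erase w).image f).card < k :=
    Finset.card_image_le.trans_lt ((Finset.card_erase_lt_of_mem hw).trans_le hS)
  obtain ⟨x, hxA, hx, hxadj⟩ : ∃ x ∈ A, x ∉ (S.erase w).image f ∧
      ∀ b ∈ S, F.Adj w b → G.Adj x (f b) := by
    by_cases h : ∃ b ∈ S, F.Adj w b
    · obtain ⟨b, hb, hwb⟩ := h
      have hbA : f b ∈ A := hmem b (Finset.mem_erase.2 ⟨hwb.ne', hb⟩)
      obtain ⟨x, hx, hx'⟩ := Finset.exists_mem_notMem_of_card_lt_card (hcard.trans_le (hA _ hbA))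
      rw [Finset.mem_filter] at hx
      refine ⟨x, hx.1, hx', fun b' hb' hwb' => ?_⟩
      have : (⟨b, hb⟩ : (S : Set W)) = ⟨b', hb'⟩ := huniq _ _ hwb hwb'
      obtain rfl : b = b' := congrArg Subtype.val this
      exact hx.2.symm
    · obtain ⟨x, hx, hx'⟩ := Finset.exists_mem_notMem_of_card_lt_card (hcard.trans_le (hA _ hv₀))
      exact ⟨x, (Finset.mem_filter.1 hx).1, hx', fun b hb hwb => absurd ⟨b, hb, hwb⟩ h⟩
  have hne : ∀ b ∈ S, b ≠ w → f b ≠ x := fun b hb hbw h =>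
    hx (Finset.mem_image.2 ⟨b, Finset.mem_erase.2 ⟨hbw, hb⟩, h⟩)
  refine ⟨Function.update f w x, ?_, ?_, ?_⟩
  · intro a ha b hb hab
    simp only [Function.update_apply] at hab
    split_ifs at hab with h1 h2 h2
    · exact h1.trans h2.symm
    · exact absurd hab.symm (hne b hb h2)
    · exact absurd hab (hne a ha h1)
    · exact hinj (Finset.mem_coe.2 (Finset.mem_erase.2 ⟨h1, ha⟩))
        (Finset.mem_coe.2 (Finset.mem_erase.2 ⟨h2, hb⟩)) hab
  · intro a ha
    simp only [Function.update_apply]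
    split_ifs with h1
    · exact hxA
    · exact hmem a (Finset.mem_erase.2 ⟨h1, ha⟩)
  · intro a ha b hb hab
    simp only [Function.update_apply]
    split_ifs with h1 h2 h2
    · exact absurd (h1.trans h2.symm) hab.ne
    · subst h1; exact hxadj b hb hab
    · subst h2; exact (hxadj a ha hab.symm).symm
    · exact hadj a (Finset.mem_erase.2 ⟨h1, ha⟩) b (Finset.mem_erase.2 ⟨h2, hb⟩) hab

/-- If every nonempty subset of `B` has a vertex with fewer than `k` neighbours in that subset,
then the graph induced on `B` is `k`-colorable. -/
theorem exists_coloring_of_degenerate {V : Type*} [DecidableEq V] (G : SimpleGraph V)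
    [DecidableRel G.Adj] {k : ℕ} (hk : 0 < k) (B : Finset V)
    (hB : ∀ A ⊆ B, A.Nonempty → ∃ v ∈ A, (A.filter (G.Adj v)).card < k) :
    ∃ c : V → Fin k, ∀ u ∈ B, ∀ v ∈ B, G.Adj u v → c u ≠ c v := by
  induction B using Finset.strongInduction with
  | H B ih =>
  rcases B.eq_empty_or_nonempty with rfl | hne
  · exact ⟨fun _ => ⟨0, hk⟩, by simp⟩
  obtain ⟨w, hw, hdeg⟩ := hB B subset_rfl hne
  obtain ⟨c, hc⟩ := ih (B.erase w) (Finset.erase_ssubset hw)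
    fun A hA => hB A (hA.trans (Finset.erase_subset _ _))
  obtain ⟨x, -, hx⟩ := Finset.exists_mem_notMem_of_card_lt_card
    (s := (B.filter (G.Adj w)).image c) (t := Finset.univ)
    (Finset.card_image_le.trans_lt (by simpa using hdeg))
  have hxc : ∀ b ∈ B, G.Adj w b → c b ≠ x := fun b hb hwb h =>
    hx (Finset.mem_image.2 ⟨b, Finset.mem_filter.2 ⟨hb, hwb⟩, h⟩)
  refine ⟨Function.update c w x, fun a ha b hb hab => ?_⟩
  simp only [Function.update_apply]
  split_ifs with h1 h2 h2
  · exact absurd (h1.trans h2.symm) hab.ne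
  · subst h1; exact (hxc b hb hab).symm
  · subst h2; exact hxc a ha hab.symm
  · exact hc a (Finset.mem_erase.2 ⟨h1, ha⟩) b (Finset.mem_erase.2 ⟨h2, hb⟩) hab

/-! ### Bounds for the fractional chromatic number -/

theorem hasFoldColoring_foldChromaticNumber {V : Type*} [Finite V] (G : SimpleGraph V) (b : ℕ) :
    G.HasFoldColoring (G.foldChromaticNumber b) b :=
  Nat.sInf_mem (exists_hasFoldColoring G b)

theorem fractionalChromaticNumber_le_div {V : Type*} [Finite V] {G : SimpleGraph V} {a b : ℕ}
    (hb : 0 < b) (h : G.HasFoldColoring a b) : G.fractionalChromaticNumber ≤ (a : ℝ) / b := by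
  refine (ciInf_le ⟨0, ?_⟩ (⟨b, hb⟩ : ℕ+)).trans ?_
  · rintro _ ⟨b, rfl⟩
    positivity
  · have : G.foldChromaticNumber b ≤ a := Nat.sInf_le h
    simp only [PNat.mk_coe]
    gcongr

/-- A family of sets of colors of size at least `b`, disjoint along edges, bounds the fractional
chromatic number. -/
theorem fractionalChromaticNumber_le_of_family {V P : Type*} [Finite V] [Fintype P]
    {G : SimpleGraph V} {b : ℕ} (hb : 0 < b) (f : V → Finset P) (hf : ∀ v, b ≤ (f v).card)
    (hdisj : ∀ u v, G.Adj u v → Disjoint (f u) (f v)) :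
    G.fractionalChromaticNumber ≤ (Fintype.card P : ℝ) / b := by
  choose g hg hcard using fun v => Finset.exists_subset_card_eq (hf v)
  refine fractionalChromaticNumber_le_div hb
    ⟨fun v => (g v).map (Fintype.equivFin P).toEmbedding, fun v => by simp [hcard], ?_⟩
  intro u v huv
  rw [Finset.disjoint_map]
  exact (hdisj u v huv).mono (hg u) (hg v)

theorem fractionalChromaticNumber_le_card {V : Type*} [Fintype V] (G : SimpleGraph V) :
    G.fractionalChromaticNumber ≤ Fintype.card V := by
  have := fractionalChromaticNumber_le_of_family (G := G) one_pos (fun v => ({v} : Finset V))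
    (by simp) (fun u v h => by simpa using h.ne)
  simpa using this

/-- If every independent set has at most `α` vertices, then `χ_f(G) ≥ |V| / α`. -/
theorem le_fractionalChromaticNumber {V : Type*} [Fintype V] (G : SimpleGraph V) {C : ℝ}
    (hC : ∀ S : Finset V, (∀ u ∈ S, ∀ v ∈ S, ¬ G.Adj u v) → C * S.card ≤ Fintype.card V)
    (hV : 0 < Fintype.card V) :
    C ≤ G.fractionalChromaticNumber := by
  classical
  refine le_ciInf fun b => ?_
  have hb : (0 : ℝ) < ((b : ℕ) : ℝ) := by exact_mod_cast b.pos
  rw [le_div_iff₀ hb]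
  have hcol := hasFoldColoring_foldChromaticNumber G b
  generalize G.foldChromaticNumber b = a at hcol ⊢
  obtain ⟨f, hf, hd⟩ := hcol
  -- Double counting of incidences between vertices and their colors; each color class is
  -- independent.
  have hsum : ∑ x : Fin a, (Finset.univ.filter fun v => x ∈ f v).card = Fintype.card V * b := by
    refine (Finset.sum_card_bipartiteAbove_eq_sum_card_bipartiteBelow (fun v x => x ∈ f v)
      (s := Finset.univ) (t := Finset.univ)).symm.trans ?_
    simp [Finset.bipartiteAbove, hf]
  have hsum' : ∑ x : Fin a, ((Finset.univ.filter fun v => x ∈ f v).card : ℝ)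
      = Fintype.card V * b := by exact_mod_cast hsum
  have hle : ∑ x : Fin a, C * ((Finset.univ.filter fun v => x ∈ f v).card : ℝ)
      ≤ ∑ x : Fin a, (Fintype.card V : ℝ) := by
    refine Finset.sum_le_sum fun x _ => hC _ ?_
    intro u hu v hv huv
    simp only [Finset.mem_filter, Finset.mem_univ, true_and] at hu hv
    exact Finset.disjoint_left.1 (hd u v huv) hu hv
  rw [← Finset.mul_sum, hsum'] at hle
  simp only [Finset.sum_const, Finset.card_univ, Fintype.card_fin, nsmul_eq_mul] at hle
  have hV' : (0 : ℝ) < Fintype.card V := by exact_mod_cast hV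
  nlinarith

/-- The fractional chromatic number does not increase along homomorphisms. -/
theorem fractionalChromaticNumber_le_of_hom {V V' : Type*} [Finite V] [Finite V']
    {G : SimpleGraph V} {G' : SimpleGraph V'} (φ : G →g G') :
    G.fractionalChromaticNumber ≤ G'.fractionalChromaticNumber := by
  refine le_ciInf fun b => ?_
  obtain ⟨f, hf, hd⟩ := hasFoldColoring_foldChromaticNumber G' b
  exact fractionalChromaticNumber_le_div b.pos
    ⟨fun v => f (φ v), fun v => hf _, fun u v huv => hd _ _ (φ.map_adj huv)⟩

/-! ### Power means and densities of blow-ups -/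

theorem pow_sum_div_card_le {ι : Type*} [Fintype ι] [Nonempty ι] (f : ι → ℝ) (hf : ∀ i, 0 ≤ f i)
    (m : ℕ) : ((∑ i, f i) / Fintype.card ι) ^ m ≤ (∑ i, f i ^ m) / Fintype.card ι := by
  have hι : (0 : ℝ) < Fintype.card ι := by exact_mod_cast Fintype.card_pos
  cases m with
  | zero => simp [hι.ne']
  | succ m =>
    have := pow_sum_div_card_le_sum_pow (s := Finset.univ) (f := f) (fun i _ => hf i) m
    rw [Finset.card_univ, div_le_iff₀ (by positivity)] at this
    rw [div_pow, div_le_div_iff₀ (by positivity) hι, pow_succ (Fintype.card ι : ℝ)]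
    calc _ ≤ ((∑ i, f i ^ (m + 1)) * (Fintype.card ι : ℝ) ^ m) * Fintype.card ι := by gcongr
      _ = _ := by ring

theorem sum_fin_succ_pi {κ : Type*} [Fintype κ] [DecidableEq κ] (s : ℕ) (h : (Fin (s + 1) → κ) → ℝ) :
    ∑ x, h x = ∑ v : κ, ∑ x : Fin s → κ, h (Fin.cons v x) := by
  rw [← Fintype.sum_prod_type' (f := fun v x => h (Fin.cons v x))]
  exact (Equiv.sum_comp (Fin.consEquiv fun _ => κ) h).symm

theorem prod_fin_succ_pi {κ : Type*} [Fintype κ] [DecidableEq κ] (s : ℕ)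
    (h : (Fin (s + 1) → κ) → ℝ) :
    ∏ x, h x = ∏ v : κ, ∏ x : Fin s → κ, h (Fin.cons v x) := by
  rw [← Fintype.prod_prod_type' (f := fun v x => h (Fin.cons v x))]
  exact (Equiv.prod_comp (Fin.consEquiv fun _ => κ) h).symm

/-- The density of the `t`-fold blow-up of an `s`-ary weight function is at least the
`t ^ s`-th power of the density of the function. -/
theorem density_pow_le_density_blowup {V : Type*} [Fintype V] [DecidableEq V] [Nonempty V]
    (t s : ℕ) (g : (Fin s → V) → ℝ) (hg : ∀ x, 0 ≤ g x) :
    ((∑ x, g x) / (Fintype.card V : ℝ) ^ s) ^ (t ^ s) ≤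
      (∑ y : Fin s → Fin t → V, ∏ σ : Fin s → Fin t, g fun i => y i (σ i)) /
        (Fintype.card V : ℝ) ^ (t * s) := by
  have hn : (0 : ℝ) < Fintype.card V := by exact_mod_cast Fintype.card_pos
  induction s with
  | zero =>
    have : ∀ x : Fin 0 → V, g x = g Fin.elim0 := fun x => congrArg g (Subsingleton.elim _ _)
    simp [this]
  | succ s ih =>
    set n : ℝ := ((Fintype.card V : ℕ) : ℝ) with hn'
    set P : V → (Fin s → Fin t → V) → ℝ :=
      fun v y => ∏ σ : Fin s → Fin t, g (Fin.cons v fun i => y i (σ i)) with hP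
    have hP0 : ∀ v y, 0 ≤ P v y := fun v y => Finset.prod_nonneg fun _ _ => hg _
    have hsplit : (∑ x, g x) / n ^ (s + 1)
        = (∑ v, (∑ x : Fin s → V, g (Fin.cons v x)) / n ^ s) / n := by
      rw [sum_fin_succ_pi, ← Finset.sum_div, div_div, pow_succ]
    -- Power mean over the first coordinate `v`, then the induction hypothesis for each fixed `v`.
    have h1 : ((∑ x, g x) / n ^ (s + 1)) ^ (t ^ s)
        ≤ (∑ y : Fin s → Fin t → V, (∑ v, P v y) / n) / n ^ (t * s) := by
      rw [hsplit]
      calc _ ≤ (∑ v, ((∑ x : Fin s → V, g (Fin.cons v x)) / n ^ s) ^ (t ^ s)) / n :=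
            pow_sum_div_card_le _ (fun v => div_nonneg (Finset.sum_nonneg fun _ _ => hg _)
              (by positivity)) _
        _ ≤ (∑ v, (∑ y : Fin s → Fin t → V, P v y) / n ^ (t * s)) / n := by
            gcongr with v
            exact ih (fun x => g (Fin.cons v x)) fun _ => hg _
        _ = _ := by
            rw [← Finset.sum_div, ← Finset.sum_div, Finset.sum_comm, div_right_comm]
    have hcard : (Fintype.card (Fin s → Fin t → V) : ℝ) = n ^ (t * s) := by
      simp [hn', pow_mul]
    have hbase : 0 ≤ (∑ x, g x) / n ^ (s + 1) :=
      div_nonneg (Finset.sum_nonneg fun _ _ => hg _) (by positivity)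
    calc ((∑ x, g x) / n ^ (s + 1)) ^ (t ^ (s + 1))
        = (((∑ x, g x) / n ^ (s + 1)) ^ (t ^ s)) ^ t := by rw [pow_succ t, pow_mul]
      _ ≤ ((∑ y : Fin s → Fin t → V, (∑ v, P v y) / n) / n ^ (t * s)) ^ t := by gcongr
      -- A second power mean, over `y`; expanding the `t`-th power then creates the `t` copies of
      -- the first coordinate.
      _ ≤ (∑ y : Fin s → Fin t → V, ((∑ v, P v y) / n) ^ t) / n ^ (t * s) := by
          rw [← hcard]
          exact pow_sum_div_card_le _
            (fun y => div_nonneg (Finset.sum_nonneg fun v _ => hP0 v y) hn.le) _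
      _ = (∑ y : Fin s → Fin t → V, ∑ z : Fin t → V, ∏ j, P (z j) y) / n ^ (t * (s + 1)) := by
          have : ∀ y, (∑ v, P v y) ^ t = ∑ z : Fin t → V, ∏ j, P (z j) y := fun y => by
            rw [Finset.sum_pow', Fintype.piFinset_univ]
          simp_rw [div_pow, this]
          rw [← Finset.sum_div, div_div, ← pow_add, mul_add, mul_one, add_comm]
      _ = _ := by
          congr 1
          rw [sum_fin_succ_pi, Finset.sum_comm]
          refine Finset.sum_congr rfl fun z _ => Finset.sum_congr rfl fun y _ => ?_
          rw [prod_fin_succ_pi]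
          refine Finset.prod_congr rfl fun j _ => Finset.prod_congr rfl fun σ _ => ?_
          congr 1
          funext i
          refine Fin.cases ?_ (fun i => ?_) i <;> simp

/-! ### Counting cliques and blow-ups in neighbourhoods -/

/-- The vertices `x` form a clique and are all adjacent to all vertices of `A`. -/
def IsCliqueOver {V : Type*} (G : SimpleGraph V) (A : Finset V) {m : ℕ} (x : Fin m → V) : Prop :=
  (∀ i j, i ≠ j → G.Adj (x i) (x j)) ∧ ∀ a ∈ A, ∀ i, G.Adj a (x i)

theorem isCliqueOver_cons {V : Type*} [DecidableEq V] (G : SimpleGraph V) (A : Finset V) {m : ℕ}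
    (v : V) (x : Fin m → V) :
    G.IsCliqueOver A (Fin.cons v x : Fin (m + 1) → V) ↔
      (∀ a ∈ A, G.Adj a v) ∧ G.IsCliqueOver (insert v A) x := by
  simp only [IsCliqueOver, Fin.forall_fin_succ, Fin.cons_zero, Fin.cons_succ, Finset.mem_insert,
    forall_eq_or_imp, ne_eq, not_true_eq_false, false_imp_iff, true_and, Fin.succ_ne_zero,
    not_false_eq_true, true_imp_iff, Fin.succ_inj, (Fin.succ_ne_zero _).symm]
  constructor
  · rintro ⟨⟨h1, h2⟩, h3⟩
    exact ⟨fun a ha => (h3 a ha).1, fun i => (h2 i).2, h1, fun a ha => (h3 a ha).2⟩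
  · rintro ⟨h1, h2, h3, h4⟩
    exact ⟨⟨h3, fun i => ⟨(h3 i).symm, h2 i⟩⟩, fun a ha => ⟨h1 a ha, h4 a ha⟩⟩

/-- Greedy lower bound for the number of cliques in a common neighbourhood. -/
theorem pow_le_card_isCliqueOver {V : Type*} [Fintype V] [DecidableEq V] (G : SimpleGraph V)
    [DecidableRel G.Adj] {s : ℕ} {β : ℝ} (hβ : 0 ≤ β)
    (h : ∀ A : Finset V, A.card ≤ s → β ≤ (Finset.univ.filter fun v => ∀ a ∈ A, G.Adj a v).card)
    (m : ℕ) (A : Finset V) (hA : A.card + m ≤ s + 1) :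
    β ^ m ≤ ∑ x : Fin m → V, open Classical in if G.IsCliqueOver A x then (1 : ℝ) else 0 := by
  classical
  induction m generalizing A with
  | zero => simp [IsCliqueOver]
  | succ m ih =>
    rw [sum_fin_succ_pi]
    simp_rw [isCliqueOver_cons, ite_and]
    calc β ^ (m + 1) = β * β ^ m := pow_succ' _ _
      _ ≤ (Finset.univ.filter fun v => ∀ a ∈ A, G.Adj a v).card * β ^ m := by
          gcongr; exact h A (by omega)
      _ = ∑ v, if ∀ a ∈ A, G.Adj a v then β ^ m else 0 := by
          rw [← Finset.sum_filter, Finset.sum_const, nsmul_eq_mul]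
      _ ≤ _ := by
          refine Finset.sum_le_sum fun v _ => ?_
          by_cases hv : ∀ a ∈ A, G.Adj a v
          · simp only [if_pos hv]
            exact ih (insert v A) (by have := Finset.card_insert_le v A; omega)
          · simp [if_neg hv]

theorem le_card_commonNeighbors {V : Type*} [Fintype V] [DecidableEq V] (G : SimpleGraph V)
    [DecidableRel G.Adj] (A : Finset V) :
    (Fintype.card V : ℝ) - A.card * (Fintype.card V - G.minDegree) ≤
      (Finset.univ.filter fun v => ∀ a ∈ A, G.Adj a v).card := by
  have hc : (Finset.univ.filter fun v => ∀ a ∈ A, G.Adj a v)ᶜ ⊆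
      A.biUnion fun a => (G.neighborFinset a)ᶜ := by
    intro v hv
    simpa using hv
  have h1 : ((Finset.univ.filter fun v => ∀ a ∈ A, G.Adj a v)ᶜ.card : ℝ) ≤
      A.card * (Fintype.card V - G.minDegree) := by
    calc _ ≤ ((A.biUnion fun a => (G.neighborFinset a)ᶜ).card : ℝ) := by
          exact_mod_cast Finset.card_le_card hc
      _ ≤ ∑ a ∈ A, (((G.neighborFinset a)ᶜ).card : ℝ) := by exact_mod_cast Finset.card_biUnion_le
      _ ≤ ∑ a ∈ A, ((Fintype.card V : ℝ) - G.minDegree) := by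
          refine Finset.sum_le_sum fun a _ => ?_
          rw [Finset.card_compl, Nat.cast_sub (Finset.card_le_univ _), card_neighborFinset_eq_degree]
          gcongr
          exact G.minDegree_le_degree a
      _ = _ := by simp [mul_sub]
  rw [Finset.card_compl, Nat.cast_sub (Finset.card_le_univ _)] at h1
  linarith

/-- Under the minimum degree condition, a positive proportion of the `s`-tuples of `t`-tuples of
vertices are such that every transversal is a clique in the neighbourhood of `u`. -/
theorem le_card_blowup {V : Type*} [Fintype V] [DecidableEq V] (G : SimpleGraph V)
    [DecidableRel G.Adj] {s : ℕ} (hs : 1 ≤ s) {ε : ℝ} (hε : 0 < ε)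
    (hG : (((s : ℝ) - 1) / s + ε) * Fintype.card V ≤ G.minDegree) (t : ℕ) (u : V) :
    open Classical in
    ε ^ (s * t ^ s) * (Fintype.card V : ℝ) ^ (t * s) ≤
      (Finset.univ.filter fun y : Fin s → Fin t → V =>
        ∀ σ : Fin s → Fin t, G.IsCliqueOver {u} fun i => y i (σ i)).card := by
  classical
  have : Nonempty V := ⟨u⟩
  have hn : (0 : ℝ) < Fintype.card V := by exact_mod_cast Fintype.card_pos
  have hs' : (1 : ℝ) ≤ s := by exact_mod_cast hs
  -- Each vertex misses at most `(1 / s - ε) n` vertices, so `s` of them leave at least `s ε n ≥ ε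
  -- n`.
  have hcommon : ∀ A : Finset V, A.card ≤ s →
      ε * Fintype.card V ≤ ((Finset.univ.filter fun v => ∀ a ∈ A, G.Adj a v).card : ℝ) := by
    intro A hA
    refine le_trans ?_ (le_card_commonNeighbors G A)
    have hdeg : (G.minDegree : ℝ) ≤ Fintype.card V := by
      exact_mod_cast (G.minDegree_le_degree u).trans (G.degree_lt_card_verts u).le
    have hA' : (A.card : ℝ) ≤ s := by exact_mod_cast hA
    have h1 : (A.card : ℝ) * (Fintype.card V - G.minDegree) ≤
        s * (Fintype.card V - G.minDegree) := by
      have := sub_nonneg.2 hdeg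
      gcongr
    have h2 : (s : ℝ) * ((((s : ℝ) - 1) / s + ε) * Fintype.card V) ≤ s * G.minDegree := by gcongr
    have h3 : (s : ℝ) * ((((s : ℝ) - 1) / s + ε) * Fintype.card V)
        = (s - 1 + s * ε) * Fintype.card V := by
      field_simp
    have h4 : ε * Fintype.card V ≤ s * (ε * Fintype.card V) :=
      le_mul_of_one_le_left (by positivity) hs'
    linarith
  have hcl := pow_le_card_isCliqueOver G (by positivity) hcommon s {u} (by simp [add_comm])
  have hden := density_pow_le_density_blowup t s
    (fun x : Fin s → V => if G.IsCliqueOver {u} x then (1 : ℝ) else 0)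
    (fun x => by split_ifs <;> simp)
  have hlow : ε ^ (s * t ^ s) ≤ ((∑ x : Fin s → V, if G.IsCliqueOver {u} x then (1 : ℝ) else 0) /
      (Fintype.card V : ℝ) ^ s) ^ (t ^ s) := by
    rw [pow_mul]
    gcongr
    rw [le_div_iff₀ (by positivity), ← mul_pow]
    exact hcl
  have := hlow.trans hden
  rw [le_div_iff₀ (by positivity)] at this
  refine this.trans (le_of_eq ?_)
  rw [Finset.card_filter]
  push_cast
  refine Finset.sum_congr rfl fun y _ => ?_
  rw [Finset.prod_ite_zero]
  simp

/-! ### Upper bound on the threshold -/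

/-- The vertices of `H` can be partitioned into `s` independent sets and a set inducing a forest. -/
def HasForestPartition {W : Type*} (H : SimpleGraph W) (s : ℕ) : Prop :=
  ∃ f : W → Option (Fin s), (∀ i u v, f u = some i → f v = some i → ¬ H.Adj u v) ∧
    (H.induce {w | f w = none}).IsAcyclic

/-- The families `y i` are injective and span a complete `s`-partite graph. -/
def IsBlowup {V : Type*} (G : SimpleGraph V) {s t : ℕ} (y : Fin s → Fin t → V) : Prop :=
  (∀ i, Function.Injective (y i)) ∧ ∀ i j a b, i ≠ j → G.Adj (y i a) (y j b)

/-- In an `H`-free graph, the common neighbourhood of a large complete multipartite graph has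
bounded chromatic number, provided that `H` has a suitable forest partition. -/
theorem IsBlowup.exists_coloring {V W : Type*} [Fintype V] [Fintype W] [Nonempty W]
    {H : SimpleGraph W} {G : SimpleGraph V} {s : ℕ} (hH : H.HasForestPartition s)
    (hfree : H.Free G) {y : Fin s → Fin (Fintype.card W) → V} (hy : G.IsBlowup y) :
    ∃ c : V → Fin (Fintype.card W), ∀ u v, (∀ i a, G.Adj u (y i a)) → (∀ i a, G.Adj v (y i a)) →
      G.Adj u v → c u ≠ c v := by
  classical
  obtain ⟨f, hf, hF⟩ := hH
  suffices h : ∃ c : V → Fin (Fintype.card W),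
      ∀ u ∈ Finset.univ.filter (fun u => ∀ i a, G.Adj u (y i a)),
      ∀ v ∈ Finset.univ.filter (fun u => ∀ i a, G.Adj u (y i a)), G.Adj u v → c u ≠ c v by
    simp only [Finset.mem_filter, Finset.mem_univ, true_and] at h
    exact h.imp fun c hc u v hu hv => hc u hu v hv
  refine exists_coloring_of_degenerate G Fintype.card_pos _ fun A hA hne => ?_
  -- A set `A` of minimum degree at least `|W|` receives the forest part of `H`; the independent
  -- classes go into the families `y i`.
  by_contra! hdeg
  obtain ⟨φ, hinj, hmem, hadj⟩ := hF.exists_injOn_map_adj G hne hdeg Finset.univ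
    ((Finset.card_univ).trans_le (Fintype.card_subtype_le _))
  have hφ : ∀ w i a, G.Adj (φ w) (y i a) := fun w =>
    (Finset.mem_filter.1 (hA (hmem w (Finset.mem_univ _)))).2
  -- Each vertex of `H` gets its own position, used in whichever family its class selects.
  let e := Fintype.equivFin W
  have : ∀ w, ∃ v, (∀ h : f w = none, v = φ ⟨w, h⟩) ∧ ∀ i, f w = some i → v = y i (e w) := by
    intro w
    by_cases h : f w = none
    · exact ⟨φ ⟨w, h⟩, fun _ => rfl, fun i hi => by simp [h] at hi⟩
    · obtain ⟨i, hi⟩ := Option.ne_none_iff_exists'.1 h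
      refine ⟨y i (e w), fun h' => absurd h' h, fun j hj => ?_⟩
      rw [Option.some.inj (hi.symm.trans hj)]
  choose ψ hψ0 hψ1 using this
  -- Images of different classes are always adjacent, which also makes them distinct.
  have key : ∀ a b, f a ≠ f b → G.Adj (ψ a) (ψ b) := by
    intro a b hab
    rcases ha : f a with _ | i <;> rcases hb : f b with _ | j
    · exact absurd (ha.trans hb.symm) hab
    · rw [hψ0 a ha, hψ1 b j hb]
      exact hφ _ _ _
    · rw [hψ0 b hb, hψ1 a i ha]
      exact (hφ _ _ _).symm
    · rw [hψ1 a i ha, hψ1 b j hb]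
      refine hy.2 _ _ _ _ ?_
      rintro rfl
      exact hab (ha.trans hb.symm)
  refine hfree ⟨⟨⟨ψ, ?_⟩, ?_⟩⟩
  · intro a b hab
    by_cases hfab : f a = f b
    · rcases ha : f a with _ | i
      · have hb : f b = none := hfab ▸ ha
        rw [hψ0 a ha, hψ0 b hb]
        exact hadj _ (Finset.mem_univ _) _ (Finset.mem_univ _) hab
      · exact absurd hab (hf i a b ha (hfab ▸ ha))
    · exact key a b hfab
  · intro a b hab
    change ψ a = ψ b at hab
    by_cases hfab : f a = f b
    · rcases ha : f a with _ | i
      · have hb : f b = none := hfab ▸ ha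
        rw [hψ0 a ha, hψ0 b hb] at hab
        simpa using hinj (by simp) (by simp) hab
      · rw [hψ1 a i ha, hψ1 b i (hfab ▸ ha)] at hab
        exact e.injective (hy.1 i hab)
    · exact absurd hab (key a b hfab).ne

/-- If `y i a = y i b` with `a ≠ b`, the entry at `(i, a)` is redundant and can be overwritten by an
arbitrary vertex without losing information. Each of the `s t²` possible coincidences thus has
proportion at most `1 / n`. -/
theorem card_mul_card_not_injective_le {V : Type*} [Fintype V] (s t : ℕ) :
    open Classical in
    Fintype.card V * (Finset.univ.filter fun y : Fin s → Fin t → V =>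
      ¬ ∀ i, Function.Injective (y i)).card ≤ s * (t * t) * Fintype.card V ^ (t * s) := by
  classical
  have hsub : (Finset.univ.filter fun y : Fin s → Fin t → V => ¬ ∀ i, Function.Injective (y i)) ⊆
      (Finset.univ : Finset (Fin s × Fin t × Fin t)).biUnion fun q =>
        Finset.univ.filter fun y => q.2.1 ≠ q.2.2 ∧ y q.1 q.2.1 = y q.1 q.2.2 := by
    intro y hy
    simp only [Finset.mem_filter, Finset.mem_univ, true_and, not_forall, Function.Injective] at hy
    obtain ⟨i, a, b, h, hab⟩ := hy
    simp only [Finset.mem_biUnion, Finset.mem_filter, Finset.mem_univ, true_and]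
    exact ⟨(i, a, b), hab, h⟩
  have hone : ∀ q : Fin s × Fin t × Fin t, Fintype.card V * (Finset.univ.filter
      fun y : Fin s → Fin t → V => q.2.1 ≠ q.2.2 ∧ y q.1 q.2.1 = y q.1 q.2.2).card ≤
      Fintype.card V ^ (t * s) := by
    rintro ⟨i, a, b⟩
    have hc : Fintype.card V ^ (t * s) = (Finset.univ : Finset (Fin s → Fin t → V)).card := by
      simp [pow_mul]
    rw [hc, ← Finset.card_univ (α := V), ← Finset.card_product]
    refine Finset.card_le_card_of_injOn
      (fun p i' a' => if i' = i ∧ a' = a then p.1 else p.2 i' a') (by simp) ?_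
    rintro ⟨v, y⟩ hy ⟨v', y'⟩ hy' heq
    simp only [Finset.coe_product, Finset.coe_univ, Set.mem_prod, Set.mem_univ, true_and,
      Finset.coe_filter, Finset.mem_univ, Set.mem_ofPred_eq] at hy hy'
    have h := fun i' a' => congrFun (congrFun heq i') a'
    simp only at h
    have hv := h i a
    simp only [and_self, if_true] at hv
    have hb := h i b
    rw [if_neg (fun hh => hy.1 hh.2.symm), if_neg (fun hh => hy.1 hh.2.symm)] at hb
    refine Prod.ext hv ?_
    funext i' a'
    by_cases hia : i' = i ∧ a' = a
    · obtain ⟨rfl, rfl⟩ := hia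
      exact hy.2.trans (hb.trans hy'.2.symm)
    · simpa [hia] using h i' a'
  calc _ ≤ Fintype.card V * ∑ q : Fin s × Fin t × Fin t, (Finset.univ.filter
        fun y : Fin s → Fin t → V => q.2.1 ≠ q.2.2 ∧ y q.1 q.2.1 = y q.1 q.2.2).card := by
        gcongr
        exact (Finset.card_le_card hsub).trans Finset.card_biUnion_le
    _ ≤ ∑ q : Fin s × Fin t × Fin t, Fintype.card V ^ (t * s) := by
        rw [Finset.mul_sum]
        exact Finset.sum_le_sum fun q _ => hone q
    _ = _ := by simp

/-- If `H` splits into `s` independent sets and a forest, then `H`-free graphs whose minimum degree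
exceeds `((s - 1) / s + ε) n` have bounded fractional chromatic number. -/
theorem HasForestPartition.exists_fractionalChromaticNumber_le {W : Type*} [Finite W] [Nonempty W]
    {H : SimpleGraph W} {s : ℕ} (hs : 1 ≤ s) (hH : H.HasForestPartition s) {ε : ℝ} (hε : 0 < ε) :
    ∃ C : ℝ, ∀ (V : Type) [Fintype V] (G : SimpleGraph V) [DecidableRel G.Adj],
      (((s : ℝ) - 1) / s + ε) * (Fintype.card V : ℝ) ≤ (G.minDegree : ℝ) → H.Free G →
        G.fractionalChromaticNumber ≤ C := by
  classical
  have := Fintype.ofFinite W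
  set t := Fintype.card W with ht
  have ht0 : (0 : ℝ) < t := by exact_mod_cast Fintype.card_pos
  set p : ℝ := ε ^ (s * t ^ s) with hp
  have hp0 : 0 < p := by positivity
  refine ⟨max (2 * (s * (t * t)) / p) (2 * t / p), fun V _ G _ hG hfree => ?_⟩
  -- Small graphs satisfy the trivial bound `χ_f ≤ n`; for large `n` the non-injective families take
  -- up at most half of the proportion `p`.
  rcases le_or_gt (Fintype.card V : ℝ) (2 * (s * (t * t)) / p) with hsmall | hlarge
  · exact (fractionalChromaticNumber_le_card G).trans (hsmall.trans (le_max_left _ _))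
  have hn : (0 : ℝ) < Fintype.card V := lt_of_le_of_lt (by positivity) hlarge
  set n : ℝ := ((Fintype.card V : ℕ) : ℝ) with hn'
  refine le_trans ?_ (le_max_right _ _)
  choose c hc using fun y : {y : Fin s → Fin t → V // G.IsBlowup y} =>
    y.2.exists_coloring hH hfree
  set N : ℝ := n ^ (t * s) with hN
  have hN0 : 0 < N := by positivity
  have hbad : ((Finset.univ.filter fun y : Fin s → Fin t → V =>
      ¬ ∀ i, Function.Injective (y i)).card : ℝ) ≤ p / 2 * N := by
    have h1 : n * ((Finset.univ.filter fun y : Fin s → Fin t → V =>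
        ¬ ∀ i, Function.Injective (y i)).card : ℝ) ≤ s * (t * t) * N := by
      rw [hN, hn']
      exact_mod_cast card_mul_card_not_injective_le (V := V) s t
    have h2 : s * (t * t) * N ≤ n * (p / 2 * N) := by
      rw [div_lt_iff₀ hp0] at hlarge
      nlinarith
    exact le_of_mul_le_mul_left (h1.trans h2) hn
  have hgood : ∀ v : V, p / 2 * N ≤ ((Finset.univ.filter
      fun y : {y : Fin s → Fin t → V // G.IsBlowup y} => ∀ i a, G.Adj v (y.1 i a)).card : ℝ) := by
    intro v
    have h1 := le_card_blowup G hs hε hG t v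
    have h2 : (Finset.univ.filter fun y : Fin s → Fin t → V =>
        ∀ σ : Fin s → Fin t, G.IsCliqueOver {v} fun i => y i (σ i)) ⊆
        ((Finset.univ.filter fun y : {y : Fin s → Fin t → V // G.IsBlowup y} =>
          ∀ i a, G.Adj v (y.1 i a)).image Subtype.val) ∪
        (Finset.univ.filter fun y : Fin s → Fin t → V => ¬ ∀ i, Function.Injective (y i)) := by
      intro y hy
      simp only [Finset.mem_filter, Finset.mem_univ, true_and] at hy
      rw [Finset.mem_union, or_iff_not_imp_right]
      intro hinj
      simp only [Finset.mem_filter, Finset.mem_univ, true_and, not_not] at hinj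
      have hbl : G.IsBlowup y := by
        refine ⟨hinj, fun i j a b hij => ?_⟩
        -- A transversal through position `a` of family `i` and position `b` of family `j`.
        have := (hy (fun l => if l = i then a else b)).1 i j hij
        simpa [hij.symm] using this
      refine Finset.mem_image.2 ⟨⟨y, hbl⟩, ?_, rfl⟩
      simp only [Finset.mem_filter, Finset.mem_univ, true_and]
      intro i a
      exact (hy fun _ => a).2 v (by simp) i
    have h3 := (Finset.card_le_card h2).trans (Finset.card_union_le _ _)
    rw [Finset.card_image_of_injective _ Subtype.val_injective] at h3
    have h4 : ((Finset.univ.filter fun y : Fin s → Fin t → V =>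
        ∀ σ : Fin s → Fin t, G.IsCliqueOver {v} fun i => y i (σ i)).card : ℝ) ≤
        ((Finset.univ.filter fun y : {y : Fin s → Fin t → V // G.IsBlowup y} =>
          ∀ i a, G.Adj v (y.1 i a)).card : ℝ) +
        ((Finset.univ.filter fun y : Fin s → Fin t → V =>
          ¬ ∀ i, Function.Injective (y i)).card : ℝ) := by exact_mod_cast h3
    have h5 : p * N ≤ _ := h1
    linarith
  have hb : 0 < ⌈p / 2 * N⌉₊ := Nat.ceil_pos.2 (by positivity)
  -- Adjacent `u`, `v` cannot share a color `(y, x)`: both lie in the common neighbourhood of `y`,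
  -- where `c y` is proper.
  refine (fractionalChromaticNumber_le_of_family
    (P := {y : Fin s → Fin t → V // G.IsBlowup y} × Fin t) hb
    (fun v => (Finset.univ.filter fun y : {y : Fin s → Fin t → V // G.IsBlowup y} =>
      ∀ i a, G.Adj v (y.1 i a)).image fun y => (y, c y v)) ?_ ?_).trans ?_
  · intro v
    rw [Finset.card_image_of_injective _ fun y y' h => (Prod.ext_iff.1 h).1]
    exact Nat.ceil_le.2 (hgood v)
  · intro u v huv
    rw [Finset.disjoint_left]
    rintro q hq hq'
    simp only [Finset.mem_image, Finset.mem_filter, Finset.mem_univ, true_and] at hq hq'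
    obtain ⟨y, hy, rfl⟩ := hq
    obtain ⟨y', hy', h⟩ := hq'
    obtain ⟨rfl, h⟩ := Prod.ext_iff.1 h
    exact hc _ u v hy hy' huv h.symm
  · have hcard : (Fintype.card ({y : Fin s → Fin t → V // G.IsBlowup y} × Fin t) : ℝ) ≤ N * t := by
      rw [Fintype.card_prod, Fintype.card_fin]
      push_cast
      gcongr
      have := Fintype.card_subtype_le fun y : Fin s → Fin t → V => G.IsBlowup y
      have h' : Fintype.card (Fin s → Fin t → V) = Fintype.card V ^ (t * s) := by simp [pow_mul]
      rw [h'] at this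
      rw [hN, hn']
      exact_mod_cast this
    calc _ ≤ N * t / (p / 2 * N) := by
          gcongr
          exact Nat.le_ceil _
      _ = 2 * t / p := by field_simp

/-! ### Graphs without short cycles and without large independent sets -/

open Classical in
/-- Pairs of a set `U` of `u` vertices and a set of `u` indices whose pairs lie inside `U`. -/
noncomputable def densePairs {V ι : Type*} [Fintype V] [Fintype ι] (e : ι → V × V) (u : ℕ) :
    Finset (Finset V × Finset ι) :=
  (Finset.univ.powersetCard u ×ˢ Finset.univ.powersetCard u).filter
    fun q => ∀ i ∈ q.2, e i ∈ q.1 ×ˢ q.1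

theorem mem_densePairs {V ι : Type*} [Fintype V] [Fintype ι] {e : ι → V × V} {u : ℕ}
    {q : Finset V × Finset ι} :
    q ∈ densePairs e u ↔ (q.1.card = u ∧ q.2.card = u) ∧ ∀ i ∈ q.2, e i ∈ q.1 ×ˢ q.1 := by
  simp [densePairs]

/-- For fixed sets of `u` vertices and `u` indices, a proportion `(u² / |V|²)^u` of all lists
qualifies; the numbers of choices are bounded by `|V|^u` and `|ι|^u`. The factor `(|V|²)^u` on the
left avoids division. -/
theorem sum_card_densePairs_mul_le {V ι : Type*} [Fintype V] [Fintype ι] [DecidableEq V]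
    [DecidableEq ι] (u : ℕ) :
    (∑ e : ι → V × V, (densePairs e u).card) * (Fintype.card V ^ 2) ^ u ≤
      (Fintype.card V * Fintype.card ι * u ^ 2) ^ u * (Fintype.card V ^ 2) ^ Fintype.card ι := by
  have hswap : ∑ e : ι → V × V, (densePairs e u).card =
      ∑ q ∈ (Finset.univ : Finset V).powersetCard u ×ˢ (Finset.univ : Finset ι).powersetCard u,
        (Finset.univ.filter fun e : ι → V × V => ∀ i ∈ q.2, e i ∈ q.1 ×ˢ q.1).card := by
    simp_rw [densePairs, Finset.card_filter]
    rw [Finset.sum_comm]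
    refine Finset.sum_congr rfl fun q _ => Finset.sum_congr rfl fun e _ => ?_
    congr
  have hone : ∀ q ∈ (Finset.univ : Finset V).powersetCard u ×ˢ
      (Finset.univ : Finset ι).powersetCard u,
      (Finset.univ.filter fun e : ι → V × V => ∀ i ∈ q.2, e i ∈ q.1 ×ˢ q.1).card *
        (Fintype.card V ^ 2) ^ u = (u ^ 2) ^ u * (Fintype.card V ^ 2) ^ Fintype.card ι := by
    rintro ⟨U, E⟩ hq
    rw [Finset.mem_product, Finset.mem_powersetCard, Finset.mem_powersetCard] at hq
    obtain ⟨⟨-, hU⟩, -, hE⟩ := hq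
    simp only at hU hE ⊢
    have : (Finset.univ.filter fun e : ι → V × V => ∀ i ∈ E, e i ∈ U ×ˢ U) =
        Fintype.piFinset fun i => if i ∈ E then U ×ˢ U else Finset.univ := by
      ext e
      simp only [Finset.mem_filter, Finset.mem_univ, true_and, Fintype.mem_piFinset]
      refine forall_congr' fun i => ?_
      by_cases hi : i ∈ E <;> simp [hi]
    rw [this, Fintype.card_piFinset]
    simp only [apply_ite Finset.card, Finset.card_product, Finset.card_univ, Fintype.card_prod]
    rw [Finset.prod_ite, Finset.prod_const, Finset.prod_const]
    have h1 : (Finset.univ.filter fun i => i ∈ E).card = u := by simp [hE]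
    have h2 : (Finset.univ.filter fun i => i ∉ E).card = Fintype.card ι - u := by
      rw [← hE, ← Finset.card_compl]
      congr 1
      ext; simp
    have h3 : u ≤ Fintype.card ι := hE ▸ Finset.card_le_univ E
    rw [h1, h2, hU, ← sq, ← sq, mul_assoc, ← pow_add, Nat.sub_add_cancel h3]
  rw [hswap, Finset.sum_mul, Finset.sum_congr rfl hone, Finset.sum_const, Finset.card_product,
    Finset.card_powersetCard, Finset.card_powersetCard, Finset.card_univ, Finset.card_univ,
    smul_eq_mul, ← mul_assoc, mul_pow, mul_pow]
  gcongr
  · exact Nat.choose_le_pow _ _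
  · exact Nat.choose_le_pow _ _

/-- With `M = D n` pairs, the average number of dense spots is bounded independently of `n`. -/
theorem sum_card_densePairs_le {n M D : ℕ} (hn : 0 < n) (hM : M = D * n) (u : ℕ) :
    ∑ e : Fin M → Fin n × Fin n, (densePairs e u).card ≤ (D * u ^ 2) ^ u * (n ^ 2) ^ M := by
  have h := sum_card_densePairs_mul_le (V := Fin n) (ι := Fin M) u
  rw [Fintype.card_fin, Fintype.card_fin] at h
  have hV : 0 < (n ^ 2) ^ u := by positivity
  refine Nat.le_of_mul_le_mul_right (h.trans (le_of_eq ?_)) hV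
  have : n * M * u ^ 2 = D * u ^ 2 * n ^ 2 := by rw [hM]; ring
  rw [this, mul_pow]
  ring

/-- Union bound over `S`: a list avoids the `m² - m` off-diagonal pairs of `S` independently in each
entry. -/
theorem card_avoiding_le {V ι : Type*} [Fintype V] [Fintype ι] [DecidableEq V] [DecidableEq ι]
    (m : ℕ) (bad : Finset (ι → V × V))
    (hbad : ∀ e ∈ bad, ∃ S : Finset V, S.card = m ∧ ∀ i, e i ∉ S.offDiag) :
    bad.card ≤ 2 ^ Fintype.card V * (Fintype.card V ^ 2 - (m * m - m)) ^ Fintype.card ι := by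
  have hsub : bad ⊆ (Finset.univ.filter fun S : Finset V => S.card = m).biUnion fun S =>
        Fintype.piFinset fun _ => S.offDiagᶜ := by
    intro e he
    simpa using hbad e he
  refine (Finset.card_le_card hsub).trans (Finset.card_biUnion_le.trans ?_)
  calc _ = ∑ S ∈ Finset.univ.filter fun S : Finset V => S.card = m,
        (Fintype.card V ^ 2 - (m * m - m)) ^ Fintype.card ι := by
        refine Finset.sum_congr rfl fun S hS => ?_
        rw [Finset.mem_filter] at hS
        rw [Fintype.card_piFinset, Finset.prod_const, Finset.card_compl, Finset.offDiag_card, hS.2,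
          Fintype.card_prod, Finset.card_univ, sq]
    _ ≤ _ := by
        rw [Finset.sum_const, smul_eq_mul]
        gcongr
        refine (Finset.card_le_univ _).trans ?_
        simp

/-- There are lists of pairs with few dense spots that hit every large vertex set. -/
theorem exists_sparse_hitting (k C : ℕ) (hC : 1 ≤ C) :
    ∃ m n M : ℕ, 0 < m ∧ n = 2 * C * m ∧ ∃ e : Fin M → Fin n × Fin n,
      (∑ u ∈ Finset.Icc 1 k, (densePairs e u).card ≤ C * m) ∧
      ∀ S : Finset (Fin n), S.card = m → ∃ i, e i ∈ S.offDiag := by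
  classical
  have hC0 : (1 : ℝ) ≤ C := by exact_mod_cast hC
  -- `D` is chosen so that the gain per vertex, `1 / 8`, beats the factor `2` per vertex from the
  -- union bound over sets.
  obtain ⟨D, hD⟩ := exists_pow_lt_of_lt_one (show (0 : ℝ) < 1 / 8 by norm_num)
    (show 1 - 1 / (8 * (C : ℝ) ^ 2) < 1 by
      have : (0 : ℝ) < 1 / (8 * (C : ℝ) ^ 2) := by positivity
      linarith)
  obtain ⟨B, hB⟩ : ∃ B : ℕ, B = ∑ u ∈ Finset.Icc 1 k, (D * u ^ 2) ^ u := ⟨_, rfl⟩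
  -- `B` bounds the average number of dense spots and does not depend on `m`, so `m` can be taken
  -- larger than it.
  obtain ⟨m, hm⟩ : ∃ m : ℕ, m = 2 * (B + 1) := ⟨_, rfl⟩
  obtain ⟨n, hn⟩ : ∃ n : ℕ, n = 2 * C * m := ⟨_, rfl⟩
  obtain ⟨M, hM⟩ : ∃ M : ℕ, M = D * n := ⟨_, rfl⟩
  have hm2 : 2 ≤ m := by omega
  have hn0 : 0 < n := by rw [hn]; positivity
  refine ⟨m, n, M, by omega, hn, ?_⟩
  obtain ⟨T, hT⟩ : ∃ T : ℕ, T = (n ^ 2) ^ M := ⟨_, rfl⟩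
  have hT0 : 0 < T := by rw [hT]; positivity
  obtain ⟨bad, hbad⟩ : ∃ bad : Finset (Fin M → Fin n × Fin n), ∀ e, e ∈ bad ↔
      ∃ S : Finset (Fin n), S.card = m ∧ ∀ i, e i ∉ S.offDiag :=
    ⟨(Set.toFinite {e | ∃ S : Finset (Fin n), S.card = m ∧ ∀ i, e i ∉ S.offDiag}).toFinset,
      fun e => by rw [Set.Finite.mem_toFinset]; rfl⟩
  have hsum : ∑ e : Fin M → Fin n × Fin n, ∑ u ∈ Finset.Icc 1 k, (densePairs e u).card
      ≤ B * T := by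
    rw [Finset.sum_comm, hB, Finset.sum_mul]
    refine Finset.sum_le_sum fun u _ => ?_
    rw [hT]
    exact sum_card_densePairs_le hn0 hM u
  have hbadcard : 4 * bad.card ≤ T := by
    have h1 : bad.card ≤ 2 ^ n * (n ^ 2 - (m * m - m)) ^ M := by
      have := card_avoiding_le (V := Fin n) (ι := Fin M) m bad fun e => (hbad e).1
      simpa only [Fintype.card_fin] using this
    -- Since `n = 2 C m`, the fraction `1 / (8 C²)` of `n²` is `m² / 2`, which is at most `m² - m`
    -- for `m ≥ 2`.
    have h2 : ((n ^ 2 - (m * m - m) : ℕ) : ℝ) ≤ (1 - 1 / (8 * (C : ℝ) ^ 2)) * (n : ℝ) ^ 2 := by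
      have hmn : m ≤ n := by rw [hn]; nlinarith
      have hle : m * m - m ≤ n ^ 2 := (Nat.sub_le _ _).trans (by rw [sq]; gcongr)
      have hle' : m ≤ m * m := Nat.le_mul_self m
      have hm2' : (2 : ℝ) ≤ m := by exact_mod_cast hm2
      rw [Nat.cast_sub hle, Nat.cast_sub hle']
      have hnn : (n : ℝ) = 2 * C * m := by rw [hn]; push_cast; ring
      push_cast
      rw [hnn]
      have : 1 / (8 * (C : ℝ) ^ 2) * (2 * C * m) ^ 2 = m ^ 2 / 2 := by field_simp; ring
      nlinarith
    have h3 : 0 ≤ 1 - 1 / (8 * (C : ℝ) ^ 2) := by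
      rw [sub_nonneg, div_le_one (by positivity)]
      nlinarith
    have h4 : (bad.card : ℝ) ≤ (1 / 4) * T := by
      calc (bad.card : ℝ) ≤ 2 ^ n * ((n ^ 2 - (m * m - m) : ℕ) : ℝ) ^ M := by
            exact_mod_cast h1
        _ ≤ 2 ^ n * ((1 - 1 / (8 * (C : ℝ) ^ 2)) * (n : ℝ) ^ 2) ^ M := by gcongr
        _ = (2 * (1 - 1 / (8 * (C : ℝ) ^ 2)) ^ D) ^ n * T := by
            rw [mul_pow, hT, mul_pow, hM, pow_mul (1 - _)]
            push_cast
            ring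
        _ ≤ (2 * (1 / 8)) ^ n * T := by gcongr
        _ ≤ (1 / 4) * T := by
            gcongr
            calc (2 * (1 / 8) : ℝ) ^ n ≤ (2 * (1 / 8) : ℝ) ^ 1 :=
                  pow_le_pow_of_le_one (by norm_num) (by norm_num) hn0
              _ = 1 / 4 := by norm_num
    have h5 : (4 : ℝ) * bad.card ≤ T := by linarith
    exact_mod_cast h5
  -- Averaging with penalty `m` for bad lists: a total below `m` forces a good list with few dense
  -- spots.
  obtain ⟨e, -, he⟩ : ∃ e ∈ (Finset.univ : Finset (Fin M → Fin n × Fin n)),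
      (∑ u ∈ Finset.Icc 1 k, (densePairs e u).card) + (if e ∈ bad then m else 0) < m := by
    refine Finset.exists_lt_of_sum_lt ?_
    rw [Finset.sum_add_distrib, ← Finset.sum_filter, Finset.filter_mem_eq_inter,
      Finset.univ_inter, Finset.sum_const, Finset.sum_const, smul_eq_mul, smul_eq_mul,
      Finset.card_univ]
    have : Fintype.card (Fin M → Fin n × Fin n) = T := by simp [hT, sq]
    rw [this]
    have h6 : bad.card * m ≤ T * (B + 1) := by
      rw [hm]
      nlinarith
    calc _ ≤ B * T + T * (B + 1) := by gcongr
      _ < T * m := by rw [hm]; nlinarith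
  have hebad : e ∉ bad := by
    intro h
    rw [if_pos h] at he
    omega
  rw [if_neg hebad, add_zero] at he
  refine ⟨e, he.le.trans (Nat.le_mul_of_pos_left m hC), fun S hS => ?_⟩
  by_contra! h
  exact hebad ((hbad e).2 ⟨S, hS, h⟩)

/-- There are graphs without short cycles all of whose independent sets are small. -/
theorem exists_free_cycleGraph_of_small_independent_sets (k C : ℕ) (hC : 1 ≤ C) :
    ∃ (V : Type) (_ : Fintype V) (G : SimpleGraph V), 0 < Fintype.card V ∧
      (∀ S : Finset V, (∀ u ∈ S, ∀ v ∈ S, ¬ G.Adj u v) → C * S.card ≤ Fintype.card V) ∧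
      ∀ u, 3 ≤ u → u ≤ k → (cycleGraph u).Free G := by
  classical
  obtain ⟨m, n, M, hm, hn, e, hX, hhit⟩ := exists_sparse_hitting k C hC
  have hn0 : 0 < n := by rw [hn]; positivity
  let pick : Finset (Fin n) → Fin n := fun U => if h : U.Nonempty then h.choose else ⟨0, hn0⟩
  have hpick : ∀ U : Finset (Fin n), U.Nonempty → pick U ∈ U := by
    intro U hU
    simp only [pick, dif_pos hU]
    exact hU.choose_spec
  -- One vertex of each dense spot is deleted. At most half of the vertices go, and each short cycle
  -- loses a vertex.
  set R : Finset (Fin n) := (Finset.Icc 1 k).biUnion fun u =>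
    (densePairs e u).image fun q => pick q.1 with hR
  have hRcard : R.card ≤ C * m := by
    refine (Finset.card_biUnion_le.trans (Finset.sum_le_sum fun u _ => ?_)).trans hX
    exact Finset.card_image_le
  let G : SimpleGraph {v : Fin n // v ∉ R} :=
    { Adj := fun a b => a ≠ b ∧ ∃ i, e i = (a.1, b.1) ∨ e i = (b.1, a.1)
      symm := ⟨fun a b h => ⟨h.1.symm, h.2.imp fun i => Or.symm⟩⟩
      loopless := ⟨fun a h => h.1 rfl⟩ }
  have hcard : C * m ≤ Fintype.card {v : Fin n // v ∉ R} := by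
    have : Fintype.card {v : Fin n // v ∉ R} = n - R.card := by
      rw [Fintype.card_subtype_compl]
      simp
    rw [this]
    have : 2 * C * m = C * m + C * m := by ring
    omega
  refine ⟨_, inferInstance, G, (Nat.mul_pos hC hm).trans_le hcard, ?_, ?_⟩
  · intro S hS
    refine le_trans ?_ hcard
    refine Nat.mul_le_mul_left C ?_
    by_contra! hlt
    obtain ⟨S', hS', hcard'⟩ := Finset.exists_subset_card_eq hlt.le
    obtain ⟨i, hi⟩ := hhit (S'.map (Function.Embedding.subtype _)) (by rw [Finset.card_map, hcard'])
    rw [Finset.mem_offDiag] at hi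
    obtain ⟨h1, h2, h3⟩ := hi
    obtain ⟨a, ha, hae⟩ := Finset.mem_map.1 h1
    obtain ⟨b, hb, hbe⟩ := Finset.mem_map.1 h2
    simp only [Function.Embedding.subtype_apply] at hae hbe
    refine hS a (hS' ha) b (hS' hb) ⟨?_, i, Or.inl (Prod.ext hae.symm hbe.symm)⟩
    rintro rfl
    exact h3 (hae.symm.trans hbe)
  · intro u hu3 huk
    obtain ⟨l, rfl⟩ : ∃ l, u = l + 3 := ⟨u - 3, by omega⟩
    rintro ⟨φ⟩
    have hadj : ∀ j : Fin (l + 3), G.Adj (φ j) (φ (j + 1)) := fun j =>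
      φ.toHom.map_adj (by rw [cycleGraph_adj]; right; simp)
    choose x hx using fun j => (hadj j).2
    have hφ : Function.Injective fun j => (φ j).1 := Subtype.val_injective.comp φ.injective
    -- The cycle edges must use distinct indices to form a dense spot. Traversing one pair in both
    -- directions would force `2 = 0` modulo `l + 3`.
    have hxinj : Function.Injective x := by
      have htwo : ∀ a b : Fin (l + 3), a = b + 1 → a + 1 = b → False := by
        rintro a b rfl h
        rw [add_assoc, add_eq_left] at h
        have := congrArg Fin.val h
        simp only [Fin.val_add, Fin.val_one, Fin.val_zero] at this
        rw [Nat.mod_eq_of_lt (by omega)] at this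
        omega
      intro a b hab
      have ha := hx a
      have hb := hx b
      rw [hab] at ha
      rcases ha with ha | ha <;> rcases hb with hb | hb <;> rw [ha] at hb <;>
        obtain ⟨h1, h2⟩ := Prod.ext_iff.1 hb
      · exact hφ h1
      · exact (htwo a b (hφ h1) (hφ h2)).elim
      · exact (htwo a b (hφ h2) (hφ h1)).elim
      · exact hφ h2
    set U : Finset (Fin n) := Finset.univ.image fun j => (φ j).1 with hU
    have hmem : pick U ∈ R := by
      refine Finset.mem_biUnion.2 ⟨l + 3, Finset.mem_Icc.2 ⟨by omega, huk⟩, ?_⟩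
      refine Finset.mem_image.2 ⟨(U, Finset.univ.image x), ?_, rfl⟩
      refine mem_densePairs.2 ⟨⟨?_, ?_⟩, ?_⟩
      · simp [hU, Finset.card_image_of_injective _ hφ]
      · simp [Finset.card_image_of_injective _ hxinj]
      · intro i hi
        obtain ⟨j, -, rfl⟩ := Finset.mem_image.1 hi
        have hm : ∀ j, (φ j).1 ∈ U := fun j => Finset.mem_image.2 ⟨j, Finset.mem_univ _, rfl⟩
        rcases hx j with h | h <;> rw [h] <;> exact Finset.mem_product.2 ⟨hm _, hm _⟩
    have hUne : U.Nonempty := ⟨_, Finset.mem_image.2 ⟨0, Finset.mem_univ _, rfl⟩⟩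
    obtain ⟨j, -, hj⟩ := Finset.mem_image.1 (hpick U hUne)
    exact (φ j).2 (hj ▸ hmem)

/-! ### Lower bound on the threshold -/

/-- The complete `(s + 1)`-partite graph with parts `V`, with a copy of `G` placed in one part. -/
def multipartiteExtension {V : Type*} (G : SimpleGraph V) (s : ℕ) :
    SimpleGraph (V × Option (Fin s)) where
  Adj p q := p.2 ≠ q.2 ∨ (p.2 = none ∧ q.2 = none ∧ G.Adj p.1 q.1)
  symm := ⟨fun _ _ h => h.imp Ne.symm fun h => ⟨h.2.1, h.1, h.2.2.symm⟩⟩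
  loopless := ⟨fun _ h => h.elim (fun h => h rfl) fun h => G.loopless.irrefl _ h.2.2⟩

theorem isAcyclic_of_forall_free_cycleGraph {V W : Type*} [Finite W] {F : SimpleGraph W}
    {G : SimpleGraph V} {k : ℕ} (hW : Nat.card W ≤ k)
    (hG : ∀ u, 3 ≤ u → u ≤ k → (cycleGraph u).Free G) (φ : F →g G) (hφ : Function.Injective φ) :
    F.IsAcyclic := by
  rw [isAcyclic_iff_free_cycleGraph]
  rintro u hu ⟨ψ⟩
  have hcard : u ≤ Nat.card W := by
    simpa using Nat.card_le_card_of_injective ψ ψ.injective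
  exact hG u hu (hcard.trans hW) ⟨(⟨φ, hφ⟩ : F.Copy G).comp ψ⟩

/-- A copy of `H` would meet the `s` empty parts in independent sets and the part carrying `G` in a
graph with at most `|H|` vertices, hence without cycles. -/
theorem free_multipartiteExtension {V W : Type*} [Finite W] {H : SimpleGraph W}
    {G : SimpleGraph V} {s : ℕ} (hH : ¬ H.HasForestPartition s)
    (hG : ∀ u, 3 ≤ u → u ≤ Nat.card W → (cycleGraph u).Free G) :
    H.Free (G.multipartiteExtension s) := by
  rintro ⟨φ⟩
  refine hH ⟨fun w => (φ w).2, ?_, ?_⟩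
  · intro i u v hu hv huv
    rcases φ.toHom.map_adj huv with h | h
    · exact h (hu.trans hv.symm)
    · exact Option.some_ne_none i (hu.symm.trans h.1)
  · refine isAcyclic_of_forall_free_cycleGraph
      (Nat.card_le_card_of_injective _ Subtype.val_injective) hG ⟨fun w => (φ w.1).1, ?_⟩ ?_
    · rintro ⟨a, ha⟩ ⟨b, hb⟩ hab
      rcases φ.toHom.map_adj (show H.Adj a b from hab) with h | h
      · exact (h (Eq.trans ha (Eq.symm hb))).elim
      · exact h.2.2
    · rintro ⟨a, ha⟩ ⟨b, hb⟩ hab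
      exact Subtype.ext (φ.injective (Prod.ext hab (Eq.trans ha (Eq.symm hb))))

theorem le_minDegree_multipartiteExtension {V : Type*} [Fintype V] [Nonempty V]
    (G : SimpleGraph V) (s : ℕ) [DecidableRel (G.multipartiteExtension s).Adj] :
    Fintype.card V * s ≤ (G.multipartiteExtension s).minDegree := by
  classical
  refine le_minDegree_of_forall_le_degree _ _ fun p => ?_
  have : Fintype.card V * s =
      ((Finset.univ : Finset V) ×ˢ ((Finset.univ : Finset (Option (Fin s))).erase p.2)).card := by
    simp [Finset.card_product]
  rw [this, ← card_neighborFinset_eq_degree]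
  refine Finset.card_le_card fun q hq => ?_
  rw [Finset.mem_product, Finset.mem_erase] at hq
  rw [mem_neighborFinset]
  exact Or.inl hq.2.1.symm

/-- If `H` does not split into `s` independent sets and a forest, then every number in the
threshold set of `H` exceeds `s / (s + 1)`. -/
theorem lt_of_mem_fractionalThresholdSet {W : Type*} [Finite W] {H : SimpleGraph W} {s : ℕ}
    (hH : ¬ H.HasForestPartition s) {d : ℝ} (hd : d ∈ H.fractionalThresholdSet) :
    (s : ℝ) / (s + 1) < d := by
  classical
  by_contra! hle
  obtain ⟨C, hC⟩ := hd
  obtain ⟨K, hK⟩ := exists_nat_gt (max C 1)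
  have hK1 : 1 ≤ K := by
    have : (1 : ℝ) < K := (le_max_right _ _).trans_lt hK
    exact_mod_cast this.le
  obtain ⟨V, _, G, hV, hind, hcyc⟩ :=
    exists_free_cycleGraph_of_small_independent_sets (Nat.card W) K hK1
  have : Nonempty V := Fintype.card_pos_iff.1 hV
  have h1 : (K : ℝ) ≤ G.fractionalChromaticNumber :=
    le_fractionalChromaticNumber G (fun S hS => by exact_mod_cast hind S hS) hV
  have h2 : G.fractionalChromaticNumber ≤ (G.multipartiteExtension s).fractionalChromaticNumber :=
    fractionalChromaticNumber_le_of_hom ⟨fun v => (v, none), fun h => Or.inr ⟨rfl, rfl, h⟩⟩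
  have h3 := hC _ (G.multipartiteExtension s) ?_ (free_multipartiteExtension hH hcyc)
  · have : C < K := (le_max_left _ _).trans_lt hK
    linarith
  · have hmin : (Fintype.card V : ℝ) * s ≤ (G.multipartiteExtension s).minDegree := by
      exact_mod_cast le_minDegree_multipartiteExtension G s
    refine le_trans ?_ hmin
    rw [Fintype.card_prod, Fintype.card_option, Fintype.card_fin]
    push_cast
    calc d * ((Fintype.card V : ℝ) * (s + 1)) ≤ s / (s + 1) * (Fintype.card V * (s + 1)) := by
          gcongr
      _ = Fintype.card V * s := by field_simp

/-! ### Forest partitions and the decomposition family -/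

/-- Two colors suffice for the forest, and the classes in `S` are the independent sets. This serves
both to find a forest in `M(H)` and to rule out level `r - 3`. -/
theorem HasForestPartition.exists_coloring {W : Type*} {H : SimpleGraph W} {s : ℕ}
    (hH : H.HasForestPartition s) :
    ∃ (c : H.Coloring (Fin (s + 2))) (S : Finset (Fin (s + 2))), S.card = s ∧
      (H.induce {w | c w ∉ S}).IsAcyclic := by
  classical
  obtain ⟨f, hf, hF⟩ := hH
  obtain ⟨c₀⟩ := hF.colorable_two
  let g : W → Fin s ⊕ Fin 2 := fun w => if h : f w = none then Sum.inr (c₀ ⟨w, h⟩) else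
    Sum.inl ((f w).get (Option.ne_none_iff_isSome.1 h))
  have hg : ∀ {u v}, H.Adj u v → g u ≠ g v := by
    intro u v huv h
    by_cases hu : f u = none <;> by_cases hv : f v = none <;> simp only [g, hu, hv, dite_true,
      dite_false, Sum.inl.injEq, Sum.inr.injEq, reduceCtorEq] at h
    · exact c₀.valid (show (H.induce {w | f w = none}).Adj ⟨u, hu⟩ ⟨v, hv⟩ from huv) h
    · obtain ⟨i, hi⟩ := Option.ne_none_iff_exists'.1 hu
      obtain ⟨j, hj⟩ := Option.ne_none_iff_exists'.1 hv
      simp only [hi, hj, Option.get_some] at h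
      exact hf i u v hi (h ▸ hj) huv
  refine ⟨Coloring.mk (fun w => finSumFinEquiv (g w)) fun h heq => hg h
    (finSumFinEquiv.injective heq), (Finset.univ.map Function.Embedding.inl).map
      finSumFinEquiv.toEmbedding, by simp, ?_⟩
  have hmem : ∀ w, finSumFinEquiv (g w) ∉ (Finset.univ.map Function.Embedding.inl).map
      finSumFinEquiv.toEmbedding → f w = none := by
    intro w hw
    by_contra h
    refine hw (Finset.mem_map.2 ⟨g w, ?_, rfl⟩)
    simp [g, h]
  exact hF.comap ⟨fun w => ⟨w.1, hmem w.1 w.2⟩, fun h => h⟩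
    fun a b h => Subtype.ext (congrArg (fun x => x.1) h)

theorem hasForestPartition_iff {W : Type*} {H : SimpleGraph W} {s : ℕ} :
    H.HasForestPartition s ↔ ∃ F ∈ H.decompositionFamily (s + 2), F.coe.IsAcyclic := by
  classical
  constructor
  · intro h
    obtain ⟨c, S, hS, hac⟩ := h.exists_coloring
    refine ⟨_, ⟨c, S, by rw [hS], rfl⟩, ?_⟩
    exact hac.comap ⟨fun w => ⟨w.1, w.2.2⟩, fun h => Subgraph.coe_adj_sub _ _ _ h⟩
      fun a b h => Subtype.ext (congrArg (fun x => x.1) h)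
  · rintro ⟨_, ⟨c, S, hS, rfl⟩, hac⟩
    let e := S.equivFinOfCardEq (Nat.add_right_cancel hS)
    refine ⟨fun w => if h : c w ∈ S then some (e ⟨c w, h⟩) else none, ?_, ?_⟩
    · intro i u v hu hv huv
      simp only at hu hv
      split_ifs at hu hv with h1 h2
      have := e.injective (Option.some.inj (hu.trans hv.symm))
      exact c.valid huv (congrArg Subtype.val this)
    · have hnot : ∀ w, (if h : c w ∈ S then some (e ⟨c w, h⟩) else none) = none → c w ∉ S := by
        intro w hw h
        simp [h] at hw
      refine hac.comap ⟨fun w => ⟨w.1, trivial, hnot w.1 w.2⟩, fun {a b} h => ?_⟩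
        fun a b h => Subtype.ext (congrArg (fun x => x.1) h)
      rw [Subgraph.coe_adj, Subgraph.deleteVerts_adj]
      exact ⟨trivial, hnot a.1 a.2, trivial, hnot b.1 b.2, h⟩

theorem Colorable.hasForestPartition {W : Type*} {H : SimpleGraph W} {s : ℕ}
    (h : H.Colorable (s + 1)) : H.HasForestPartition s := by
  obtain ⟨c⟩ := h
  refine ⟨fun w => finSuccEquiv s (c w), fun i u v hu hv huv => c.valid huv
    ((finSuccEquiv s).injective (hu.trans hv.symm)), ?_⟩
  have : H.induce {w | finSuccEquiv s (c w) = none} = ⊥ := by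
    ext ⟨a, ha⟩ ⟨b, hb⟩
    simp only [bot_adj, iff_false]
    intro hab
    exact c.valid (show H.Adj a b from hab) ((finSuccEquiv s).injective (Eq.trans ha (Eq.symm hb)))
  rw [this]
  exact isAcyclic_bot

theorem isGLB_fractionalThresholdSet {W : Type*} [Finite W] [Nonempty W] {H : SimpleGraph W}
    {s : ℕ} (h₁ : H.HasForestPartition (s + 1)) (h₂ : ¬ H.HasForestPartition s) :
    IsGLB H.fractionalThresholdSet ((s : ℝ) / (s + 1)) := by
  refine ⟨fun d hd => (lt_of_mem_fractionalThresholdSet h₂ hd).le, fun x hx => ?_⟩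
  refine le_of_forall_pos_le_add fun ε hε => hx ?_
  have := h₁.exists_fractionalChromaticNumber_le (by omega) hε
  simpa [fractionalThresholdSet] using this

end SimpleGraph

/-- Over the reals, `IsGLB` forces the set to be non-empty and bounded below, so the threshold is a
genuine infimum and not a default value of `sInf`. -/
theorem theorem1p4 {W : Type*} [Finite W] (H : SimpleGraph W) (r : ℕ) (hr : 3 ≤ r)
    (hχ : H.chromaticNumber = (r : ℕ∞)) :
    IsGLB H.fractionalThresholdSet H.fractionalChromaticThreshold ∧
    ((∃ F ∈ H.decompositionFamily r, F.coe.IsAcyclic) →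
      H.fractionalChromaticThreshold = ((r : ℝ) - 3) / ((r : ℝ) - 2)) ∧
    ((¬ ∃ F ∈ H.decompositionFamily r, F.coe.IsAcyclic) →
      H.fractionalChromaticThreshold = ((r : ℝ) - 2) / ((r : ℝ) - 1)) ∧
    ((∃ F ∈ H.decompositionFamily r, F.coe.IsAcyclic) →
      ∀ ε : ℝ, 0 < ε → ∃ C : ℝ,
        ∀ (V : Type) [Fintype V] (G : SimpleGraph V) [DecidableRel G.Adj],
          (((r : ℝ) - 3) / ((r : ℝ) - 2) + ε) * (Fintype.card V : ℝ) ≤ (G.minDegree : ℝ) →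
          H.Free G → G.fractionalChromaticNumber ≤ C) := by
  obtain ⟨s, rfl⟩ : ∃ s, r = s + 3 := ⟨r - 3, by omega⟩
  have hcol : H.Colorable (s + 3) := SimpleGraph.chromaticNumber_le_iff_colorable.1 hχ.le
  have hncol : ¬ H.Colorable (s + 2) := fun h => by
    have := SimpleGraph.chromaticNumber_le_iff_colorable.2 h
    rw [hχ, Nat.cast_le] at this
    omega
  have hW : Nonempty W := by
    by_contra h
    rw [not_nonempty_iff] at h
    exact hncol (SimpleGraph.Colorable.of_isEmpty _)
  have hsmall : ¬ H.HasForestPartition s := fun h => by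
    obtain ⟨c, -⟩ := h.exists_coloring
    exact hncol ⟨c⟩
  have hlarge : H.HasForestPartition (s + 2) := hcol.hasForestPartition
  have hiff : H.HasForestPartition (s + 1) ↔ _ := SimpleGraph.hasForestPartition_iff
  have hc1 : (((s + 3 : ℕ) : ℝ) - 3) / (((s + 3 : ℕ) : ℝ) - 2) = (s : ℝ) / (s + 1) := by
    push_cast; congr 1 <;> ring
  have hc2 : (((s + 3 : ℕ) : ℝ) - 2) / (((s + 3 : ℕ) : ℝ) - 1) =
      ((s + 1 : ℕ) : ℝ) / ((s + 1 : ℕ) + 1) := by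
    push_cast; congr 1 <;> ring
  rw [hc1, hc2]
  have hne : ∀ {x}, IsGLB H.fractionalThresholdSet x → H.fractionalChromaticThreshold = x := by
    intro x hx
    -- Non-emptiness is witnessed by level `r - 1`, which always splits, with `ε = 1`.
    refine hx.csInf_eq ⟨((s + 2 : ℕ) - 1) / (s + 2 : ℕ) + 1, ?_⟩
    exact hlarge.exists_fractionalChromaticNumber_le (by omega) one_pos
  have key₁ : H.HasForestPartition (s + 1) → IsGLB H.fractionalThresholdSet ((s : ℝ) / (s + 1)) :=
    fun h => SimpleGraph.isGLB_fractionalThresholdSet h hsmall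
  have key₂ : ¬ H.HasForestPartition (s + 1) →
      IsGLB H.fractionalThresholdSet (((s + 1 : ℕ) : ℝ) / ((s + 1 : ℕ) + 1)) :=
    fun h => SimpleGraph.isGLB_fractionalThresholdSet hlarge h
  refine ⟨?_, fun h => hne (key₁ (hiff.2 h)), fun h => hne (key₂ fun h' => h (hiff.1 h')), ?_⟩
  · by_cases h : H.HasForestPartition (s + 1)
    · rw [hne (key₁ h)]
      exact key₁ h
    · rw [hne (key₂ h)]
      exact key₂ h
  · intro h ε hε
    have := (hiff.2 h).exists_fractionalChromaticNumber_le (by omega) hε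
    simpa using this
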